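/- **Conventions.** Let $k$ be a field. A quiver $Q$ consists of vertices and arrows with source and target (loops and multiple arrows are allowed); it is *finite* if it has finitely many vertices and arrows, and *connected* if it is nonempty and its underlying graph is connected. For a finite quiver $Q$, the path algebra $kQ$ has the paths of $Q$ (including a stationary path $e_x$ for each vertex $x$) as a $k$-basis, and the product of two paths is their composition if it is defined and $0$ otherwise. Let $F$ be the two-sided ideal of $kQ$ generated by the arrows. A two-sided ideal $I$ is *admissible* if $F^m\subseteq I\subseteq F^2$ for some $m\ge 2$. A *presentation* of a $k$-algebra $A$ is a pair $(Q,I)$ with $Q$ a finite connected quiver and $I$ an admissible ideal of $kQ$ such that $A\cong kQ/I$ as $k$-algebras. The quiver $Q$ is then determined by $A$ and is denoted $Q_A$. A *minimal relation* of $I$ is an element $\sum_{i=1}^m\lambda_i w_i\in I$, where $m\ge 2$, the $\lambda_i\in k$ are nonzero and the $w_i$ are pairwise different paths with a common source and a common target, such that $\sum_{i\in J}\lambda_i w_i\notin I$ for every nonempty proper subset $J\subset\{1,\dots,m\}$. A *walk* is a composition of arrows and formal inverses of arrows. *Homotopy* is the smallest equivalence relation $\sim$ on walks such that (1) $\alpha\alpha^{-1}\sim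 e_x$ and $\alpha^{-1}\alpha\sim e_y$ for every arrow $\alpha\colon x\to y$; (2) $w_i\sim w_j$ whenever $w_i,w_j$ occur in the same minimal relation of $I$; (3) $u\sim v$ implies $wuw'\sim wvw'$ whenever these compositions are defined. The fundamental group $\pi_1(Q,I,v_0)$ is the group of homotopy classes of closed walks at the vertex $v_0$, with the product induced by composition of walks; for connected $Q$ its isomorphism class does not depend on $v_0$ and one writes $\pi_1(Q,I)$. **Theorem A.** Let $G_1,\dots,G_n$ be finitely presented groups. Then there exist a finite-dimensional $k$-algebra $A$ and presentations $A\cong kQ_A/I_i$, $1\le i\le n$, all on the same quiver $Q_A$, such that $\pi_1(Q_A,I_i)\cong G_i$ for every $i\in\{1,\dots,n\}$. -/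

import Mathlib

universe u v w

noncomputable section

namespace BoundQuiver

open Quiver

/-- The quiver `Q` is finite: it has finitely many vertices and finitely many arrows. -/
def IsFiniteQuiver (Q : Type v) [Quiver.{w} Q] : Prop :=
  Finite Q ∧ ∀ x y : Q, Finite (x ⟶ y)

/-- The quiver `Q` is connected: its underlying graph is nonempty and any two vertices are joined
by a walk (a path in the quiver with formal inverses of all arrows added). -/
def IsConnectedQuiver (Q : Type v) [Quiver.{w} Q] : Prop :=
  Nonempty Q ∧ ∀ x y : Symmetrify Q, Nonempty (Path x y)

/-! ### The path algebra -/

/-- All paths of `Q`, with their source and target; `⟨x, x, Path.nil⟩` is the stationary path. -/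
abbrev AnyPath (Q : Type v) [Quiver.{w} Q] : Type max v w := Σ x y : Q, Path x y

/-- The path algebra `kQ`: the `k`-vector space with the set of all paths of `Q` as a basis. -/
def PathAlgebra (k : Type u) [Field k] (Q : Type v) [Quiver.{w} Q] : Type max u v w :=
  AnyPath Q →₀ k

namespace PathAlgebra

variable {k : Type u} [Field k] {Q : Type v} [Quiver.{w} Q]

instance : AddCommGroup (PathAlgebra k Q) := inferInstanceAs (AddCommGroup (AnyPath Q →₀ k))

instance : Module k (PathAlgebra k Q) := inferInstanceAs (Module k (AnyPath Q →₀ k))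

variable (k) in
/-- The basis element of `kQ` given by a path with recorded end points. -/
def of (p : AnyPath Q) : PathAlgebra k Q := Finsupp.single p 1

variable (k) in
/-- The basis element of `kQ` given by a path from `x` to `y`. -/
def ofPath {x y : Q} (p : Path x y) : PathAlgebra k Q := of k ⟨x, y, p⟩

variable (k Q) in
/-- The paths form a basis of `kQ`. -/
def basis : Module.Basis (AnyPath Q) k (PathAlgebra k Q) :=
  Module.Basis.ofRepr (LinearEquiv.refl k (AnyPath Q →₀ k))

theorem basis_apply (p : AnyPath Q) : basis k Q p = of k p := rfl

theorem lin_ext {M : Type*} [AddCommGroup M] [Module k M] {f g : PathAlgebra k Q →ₗ[k] M}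
    (h : ∀ p, f (of k p) = g (of k p)) : f = g :=
  (basis k Q).ext h

open Classical in
variable (k) in
/-- The product of two basis elements: the composition `pq` (first `p`, then `q`) if the target of
`p` is the source of `q`, and `0` otherwise. -/
def mulPaths (p q : AnyPath Q) : PathAlgebra k Q :=
  if h : p.2.1 = q.1 then ofPath k ((p.2.2.cast rfl h).comp q.2.2) else 0

variable (k Q) in
/-- The bilinear extension of the multiplication of paths. -/
def mulBilin : PathAlgebra k Q →ₗ[k] PathAlgebra k Q →ₗ[k] PathAlgebra k Q :=
  (basis k Q).constr k fun p => (basis k Q).constr k fun q => mulPaths k p q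

instance : Mul (PathAlgebra k Q) := ⟨fun f g => mulBilin k Q f g⟩

theorem mul_def (f g : PathAlgebra k Q) : f * g = mulBilin k Q f g := rfl

theorem of_mul_of (p q : AnyPath Q) : of k p * of k q = mulPaths k p q := by
  rw [mul_def, mulBilin, ← basis_apply, Module.Basis.constr_basis, ← basis_apply,
    Module.Basis.constr_basis]

theorem ofPath_mul_ofPath {x y z : Q} (p : Path x y) (q : Path y z) :
    ofPath k p * ofPath k q = ofPath k (p.comp q) := by
  simp [ofPath, of_mul_of, mulPaths]

theorem ofPath_mul_ofPath_of_ne {x y y' z : Q} (h : y ≠ y') (p : Path x y) (q : Path y' z) :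
    ofPath k p * ofPath k q = 0 := by
  simp [ofPath, of_mul_of, mulPaths, h]

theorem mul_assoc_basis (p q r : AnyPath Q) :
    of k p * of k q * of k r = of k p * (of k q * of k r) := by
  obtain ⟨a, b, p⟩ := p
  obtain ⟨c, d, q⟩ := q
  obtain ⟨e, f, r⟩ := r
  change ofPath k p * ofPath k q * ofPath k r = ofPath k p * (ofPath k q * ofPath k r)
  have z1 : ∀ x : PathAlgebra k Q, 0 * x = 0 := fun x => by simp [mul_def]
  have z2 : ∀ x : PathAlgebra k Q, x * 0 = 0 := fun x => by simp [mul_def]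
  by_cases h : b = c
  · subst h
    by_cases h' : d = e
    · subst h'
      simp only [ofPath_mul_ofPath, Path.comp_assoc]
    · simp only [ofPath_mul_ofPath, ofPath_mul_ofPath_of_ne h', z2]
  · by_cases h' : d = e
    · subst h'
      simp only [ofPath_mul_ofPath, ofPath_mul_ofPath_of_ne h, z1]
    · simp only [ofPath_mul_ofPath_of_ne h, ofPath_mul_ofPath_of_ne h', z1, z2]

instance : NonUnitalRing (PathAlgebra k Q) where
  left_distrib f g h := by simp [mul_def]
  right_distrib f g h := by simp [mul_def]
  zero_mul f := by simp [mul_def]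
  mul_zero f := by simp [mul_def]
  mul_assoc f g h := by
    have h1 : (mulBilin k Q).compr₂ (mulBilin k Q) =
        ((LinearMap.llcomp k _ _ _ ∘ₗ mulBilin k Q).flip ∘ₗ mulBilin k Q).flip := by
      refine lin_ext fun p => lin_ext fun q => lin_ext fun r => ?_
      exact mul_assoc_basis p q r
    exact congrArg (fun T => T f g h) h1

variable [Fintype Q]

/-- The identity of `kQ` is the sum of all stationary paths. -/
instance : One (PathAlgebra k Q) := ⟨∑ x : Q, ofPath k (Path.nil : Path x x)⟩

theorem one_def : (1 : PathAlgebra k Q) = ∑ x : Q, ofPath k (Path.nil : Path x x) := rfl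

theorem one_mul_of (p : AnyPath Q) : 1 * of k p = of k p := by
  obtain ⟨a, b, p⟩ := p
  change 1 * ofPath k p = ofPath k p
  rw [one_def, Finset.sum_mul, Finset.sum_eq_single a]
  · simp [ofPath_mul_ofPath]
  · intro x _ hx
    exact ofPath_mul_ofPath_of_ne hx _ _
  · simp

theorem of_mul_one (p : AnyPath Q) : of k p * 1 = of k p := by
  obtain ⟨a, b, p⟩ := p
  change ofPath k p * 1 = ofPath k p
  rw [one_def, Finset.mul_sum, Finset.sum_eq_single b]
  · simp [ofPath_mul_ofPath]
  · intro x _ hx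
    exact ofPath_mul_ofPath_of_ne hx.symm _ _
  · simp

instance : Ring (PathAlgebra k Q) where
  __ := (inferInstance : NonUnitalRing (PathAlgebra k Q))
  one_mul f := by
    have h : mulBilin k Q 1 = LinearMap.id := lin_ext fun p => one_mul_of p
    exact congrArg (fun T => T f) h
  mul_one f := by
    have h : (mulBilin k Q).flip 1 = LinearMap.id := lin_ext fun p => of_mul_one p
    exact congrArg (fun T => T f) h

instance : Algebra k (PathAlgebra k Q) :=
  Algebra.ofModule (fun r f g => by simp [mul_def]) (fun r f g => by simp [mul_def])

end PathAlgebra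

/-! ### Admissible ideals and presentations -/

section Ideals

variable (k : Type u) [Field k] (Q : Type v) [Quiver.{w} Q] [Fintype Q]

/-- The two-sided ideal `F` of `kQ` generated by the arrows of `Q`. -/
def arrowIdeal : TwoSidedIdeal (PathAlgebra k Q) :=
  TwoSidedIdeal.span {f | ∃ (x y : Q) (a : x ⟶ y), f = PathAlgebra.ofPath k a.toPath}

variable {k Q}

/-- The two-sided ideal `I` is admissible: `F ^ m ⊆ I ⊆ F ^ 2` for some `m ≥ 2`. -/
def IsAdmissible (I : TwoSidedIdeal (PathAlgebra k Q)) : Prop :=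
  ∃ m : ℕ, 2 ≤ m ∧ (arrowIdeal k Q).asIdeal ^ m ≤ I.asIdeal ∧
    I.asIdeal ≤ (arrowIdeal k Q).asIdeal ^ 2

/-- `(Q, I)` is a presentation of the `k`-algebra `A`: the quiver `Q` is finite and connected, the
two-sided ideal `I` of `kQ` is admissible, and `A ≅ kQ/I` as `k`-algebras. -/
structure IsPresentation (A : Type*) [Ring A] [Algebra k A]
    (I : TwoSidedIdeal (PathAlgebra k Q)) : Prop where
  finite : IsFiniteQuiver Q
  connected : IsConnectedQuiver Q
  admissible : IsAdmissible I
  iso : Nonempty (A ≃ₐ[k] PathAlgebra k Q ⧸ I.asIdeal)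

/-! ### The fundamental group -/

/-- `∑_{p ∈ S} c p • p` is a minimal relation of `I` from `x` to `y`: it is a combination with
nonzero coefficients of at least two different paths from `x` to `y`, it lies in `I`, and no
subsum over a nonempty proper subset of these paths lies in `I`. -/
structure IsMinimalRelation (I : TwoSidedIdeal (PathAlgebra k Q)) {x y : Q}
    (S : Finset (Path x y)) (c : Path x y → k) : Prop where
  two_le_card : 2 ≤ S.card
  coeff_ne_zero : ∀ p ∈ S, c p ≠ 0
  mem : ∑ p ∈ S, c p • PathAlgebra.ofPath k p ∈ I
  minimal : ∀ J : Finset (Path x y), J ⊂ S → J.Nonempty →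
    ∑ p ∈ J, c p • PathAlgebra.ofPath k p ∉ I

/-- Walks from `x` to `y`: compositions of arrows and of formal inverses of arrows. The quiver
`Symmetrify Q` has the vertices of `Q`, and the arrows of `Q` together with their formal inverses;
`Quiver.reverse` interchanges `α` and `α⁻¹`. -/
abbrev Walk (x y : Symmetrify Q) : Type max v w := Path x y

/-- A path, regarded as a walk. -/
def toWalk {x y : Q} (p : Path x y) : Walk (Symmetrify.of.obj x) (Symmetrify.of.obj y) :=
  Symmetrify.of.mapPath p

/-- The homotopy relation on walks: the smallest equivalence relation that identifies `e e⁻¹` with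
a stationary walk, where `e = α` or `e = α⁻¹` for an arrow `α`, that identifies any two paths
occurring in the same minimal relation, and that is compatible with composition of walks. -/
inductive Homotopic (I : TwoSidedIdeal (PathAlgebra k Q)) :
    {x y : Symmetrify Q} → Walk x y → Walk x y → Prop
  | refl {x y : Symmetrify Q} (p : Walk x y) : Homotopic I p p
  | symm {x y : Symmetrify Q} {p q : Walk x y} : Homotopic I p q → Homotopic I q p
  | trans {x y : Symmetrify Q} {p q r : Walk x y} :
      Homotopic I p q → Homotopic I q r → Homotopic I p r
  | cancel {x y : Symmetrify Q} (e : x ⟶ y) :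
      Homotopic I (e.toPath.comp (Quiver.reverse e).toPath) Path.nil
  | relation {x y : Q} {S : Finset (Path x y)} {c : Path x y → k} (h : IsMinimalRelation I S c)
      {p q : Path x y} (hp : p ∈ S) (hq : q ∈ S) : Homotopic I (toWalk p) (toWalk q)
  | comp {x y z t : Symmetrify Q} (p : Walk x y) {q q' : Walk y z} (r : Walk z t) :
      Homotopic I q q' → Homotopic I ((p.comp q).comp r) ((p.comp q').comp r)

/-- Homotopy of closed walks at `v₀`. -/
def homotopySetoid (I : TwoSidedIdeal (PathAlgebra k Q)) (v₀ : Symmetrify Q) :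
    Setoid (Walk v₀ v₀) where
  r := Homotopic I
  iseqv := ⟨Homotopic.refl, Homotopic.symm, Homotopic.trans⟩

/-- The fundamental group `π₁(Q, I, v₀)`: homotopy classes of closed walks at the vertex `v₀`. -/
def FundamentalGroup (I : TwoSidedIdeal (PathAlgebra k Q)) (v₀ : Q) : Type max v w :=
  Quotient (homotopySetoid I (Symmetrify.of.obj v₀))

namespace Homotopic

variable {I : TwoSidedIdeal (PathAlgebra k Q)} {x y z : Symmetrify Q}

theorem comp_right {p p' : Walk x y} (h : Homotopic I p p') (q : Walk y z) :
    Homotopic I (p.comp q) (p'.comp q) := by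
  have := Homotopic.comp (Path.nil : Walk x x) q h
  rwa [Path.nil_comp, Path.nil_comp] at this

theorem comp_left (p : Walk x y) {q q' : Walk y z} (h : Homotopic I q q') :
    Homotopic I (p.comp q) (p.comp q') :=
  Homotopic.comp p Path.nil h

theorem comp_reverse (p : Walk x y) : Homotopic I (p.comp p.reverse) Path.nil := by
  induction p with
  | nil => exact Homotopic.refl _
  | cons p e ih =>
    have h2 := Homotopic.comp p p.reverse (Homotopic.cancel (I := I) e)
    have e1 : Path.comp (Path.cons p e) (Path.reverse (Path.cons p e)) =
        (p.comp (e.toPath.comp (Quiver.reverse e).toPath)).comp p.reverse := by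
      rw [Path.reverse, ← Path.comp_toPath_eq_cons]
      simp only [Path.comp_assoc]
    rw [e1]
    exact h2.trans ih

theorem reverse_comp (p : Walk x y) : Homotopic I (p.reverse.comp p) Path.nil := by
  have h := comp_reverse (I := I) p.reverse
  rwa [Path.reverse_reverse] at h

theorem reverse {p q : Walk x y} (h : Homotopic I p q) : Homotopic I p.reverse q.reverse := by
  have h1 : Homotopic I (p.reverse.comp (q.comp q.reverse)) p.reverse :=
    comp_left p.reverse (comp_reverse q)
  have h2 := comp_right ((comp_left p.reverse h.symm).trans (reverse_comp p)) q.reverse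
  rw [Path.nil_comp, Path.comp_assoc] at h2
  exact h1.symm.trans h2

end Homotopic

/-- The group law of `π₁(Q, I, v₀)` is induced by the composition of walks. -/
instance (I : TwoSidedIdeal (PathAlgebra k Q)) (v₀ : Q) : Group (FundamentalGroup I v₀) where
  mul := Quotient.map₂ (fun p q : Walk (Symmetrify.of.obj v₀) (Symmetrify.of.obj v₀) => Path.comp p q)
    fun _ p' hp q _ hq => (Homotopic.comp_right hp q).trans (Homotopic.comp_left p' hq)
  one := Quotient.mk (homotopySetoid I (Symmetrify.of.obj v₀)) Path.nil
  inv := Quotient.map (fun p : Walk (Symmetrify.of.obj v₀) (Symmetrify.of.obj v₀) => Path.reverse p)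
    fun _ _ h => Homotopic.reverse h
  mul_assoc := by
    rintro ⟨p⟩ ⟨q⟩ ⟨r⟩
    exact congrArg (Quotient.mk (homotopySetoid I (Symmetrify.of.obj v₀))) (Path.comp_assoc p q r)
  one_mul := by
    rintro ⟨p⟩
    exact congrArg (Quotient.mk (homotopySetoid I (Symmetrify.of.obj v₀))) (Path.nil_comp p)
  mul_one := by
    rintro ⟨p⟩
    exact congrArg (Quotient.mk (homotopySetoid I (Symmetrify.of.obj v₀))) (Path.comp_nil p)
  inv_mul_cancel := by
    rintro ⟨p⟩
    exact Quotient.sound (s := homotopySetoid I (Symmetrify.of.obj v₀)) (Homotopic.reverse_comp p)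

end Ideals

end BoundQuiver

end

/-! An automorphism of the path algebra leaves the quotient algebra unchanged up to isomorphism, but
it can change which combinations of paths are minimal relations. The construction lets such
automorphisms switch generators off.

Each group is presented by a finite multiplication table, and `Y` is the disjoint union of the
generating families. A generator `y` is encoded by the closed walk `a y` followed by the inverse of
`a none`. The relators `a y * b none - a none * b y` and `a x * b y - a z * b none` impose the
tables. The relator `a y * c y` is a single path and imposes no homotopy. For `y` outside the `i`-th
block, replace `a y` and `b y` by `a y - a none` and `b y - b none`. The single path then becomes `a
y * c y - a none * c y`, which makes the generator `y` trivial. Only the `i`-th table survives, and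
`relatorIdeal_eq_map_shiftEquiv` shows that the algebra stays the same.

Two facts make this rigorous. There are no unwanted homotopies, because the ideal is homogeneous for
the weights of paths in `G i` (`weightProj_mem_relatorIdeal`), so that paths in one minimal relation
have equal weights. The wanted homotopies exist, because a functional vanishing on the ideal
(`augment_eq_zero_of_mem`) shows that the paths involved lie outside it, so that their differences
are minimal relations. `nonempty_fundamentalGroup_mulEquiv` combines the two. -/

noncomputable section

/-! ### Finite multiplication tables of finitely presented groups -/

/-- A finitely presented group is presented by the multiplication table of a finite family of
generators. -/
theorem Group.IsFinitelyPresented.exists_multiplication_table {G : Type v} [Group G]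
    (hG : Group.IsFinitelyPresented G) :
    ∃ (Y : Type) (_ : Finite Y) (β : Y → G), Subgroup.closure (Set.range β) = ⊤ ∧
      ∀ (H : Type w) [Group H] (f : Y → H),
        (∀ x y z, β x * β y = β z → f x * f y = f z) → ∃ φ : G →* H, ∀ y, φ (β y) = f y := by
  obtain ⟨n, φ, hφ, S, hS, hker⟩ := hG.out
  obtain ⟨N, hN⟩ : ∃ N, ∀ r ∈ S, r.toWord.length ≤ N := by
    obtain ⟨N, hN⟩ := (hS.image fun r => r.toWord.length).bddAbove
    exact ⟨N, fun r hr => hN ⟨r, hr, rfl⟩⟩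
  -- The generators are the short words. The bound `N + 1` leaves room for every relator and, even
  -- if `N = 0`, for the one-letter words.
  let W : Set (List (Fin n × Bool)) := {l | l.length ≤ N + 1}
  have memW : ∀ l : List (Fin n × Bool), l.length ≤ N + 1 → l ∈ W := fun _ h => h
  have hsingle : ∀ x : Fin n × Bool, [x] ∈ W := fun x => memW _ (by simp)
  refine ⟨W, (List.finite_length_le (Fin n × Bool) (N + 1)).to_subtype,
    fun l => φ (FreeGroup.mk l.1), ?_, ?_⟩
  · rw [← top_le_iff, ← MonoidHom.range_eq_top.2 hφ, MonoidHom.range_eq_map,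
      ← FreeGroup.closure_range_of, MonoidHom.map_closure, Subgroup.closure_le]
    rintro _ ⟨_, ⟨s, rfl⟩, rfl⟩
    exact Subgroup.subset_closure ⟨⟨[(s, true)], hsingle _⟩, rfl⟩
  · intro H _ f hf
    let ψ : FreeGroup (Fin n) →* H := FreeGroup.lift fun s => f ⟨[(s, true)], hsingle _⟩
    -- If `β y = 1`, the table contains `y * y = y`, which forces `f y = 1`.
    have hone : ∀ y : W, φ (FreeGroup.mk y.1) = 1 → f y = 1 := fun y hy => by
      have := hf y y y (by simp [hy])
      simpa using this
    have hgen : ∀ x : Fin n × Bool, f ⟨[x], hsingle x⟩ = ψ (FreeGroup.mk [x]) := by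
      rintro ⟨s, _ | _⟩
      · have h1 := hf ⟨[(s, true)], hsingle _⟩ ⟨[(s, false)], hsingle _⟩ ⟨[], memW _ (by simp)⟩
          (by
            rw [← map_mul]
            congr 1
            exact mul_inv_cancel (FreeGroup.of s))
        rw [hone ⟨[], memW _ (by simp)⟩ (map_one φ)] at h1
        rw [← inv_eq_of_mul_eq_one_right h1]
        have h2 : FreeGroup.mk [(s, false)] = (FreeGroup.of s)⁻¹ := rfl
        rw [h2, map_inv, FreeGroup.lift_apply_of]
      · exact (FreeGroup.lift_apply_of ..).symm
    -- `W` is closed under prefixes, so a word is built up one letter at a time by entries of the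
    -- table.
    have hword : ∀ (l : List (Fin n × Bool)) (hl : l ∈ W), f ⟨l, hl⟩ = ψ (FreeGroup.mk l) := by
      intro l
      induction l using List.reverseRecOn with
      | nil => exact fun hl => (hone _ (map_one φ)).trans (map_one ψ).symm
      | append_singleton l x ih =>
        intro hl
        have hl' : l ∈ W := by
          have : (l ++ [x]).length ≤ N + 1 := hl
          exact memW _ (by simp at this; omega)
        rw [← FreeGroup.mul_mk, map_mul, ← ih hl', ← hgen]
        exact (hf _ _ _ (by rw [← map_mul, FreeGroup.mul_mk])).symm
    -- Each relator is itself a word in `W` with trivial image in `G`, so `hone` makes its image in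
    -- `H` trivial.
    have hle : φ.ker ≤ ψ.ker := by
      rw [← hker]
      refine Subgroup.normalClosure_le_normal fun r hr => ?_
      have hr1 : φ r = 1 := by
        have : r ∈ φ.ker := hker ▸ Subgroup.subset_normalClosure hr
        exact this
      have := hword r.toWord (memW _ ((hN r hr).trans (Nat.le_succ N)))
      rw [FreeGroup.mk_toWord] at this
      rw [SetLike.mem_coe, MonoidHom.mem_ker, ← this]
      exact hone _ (by rw [FreeGroup.mk_toWord, hr1])
    refine ⟨φ.liftOfSurjective hφ ⟨ψ, hle⟩, fun y => ?_⟩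
    rw [hword y.1 y.2]
    exact φ.liftOfRightInverse_comp_apply _ _ ⟨ψ, hle⟩ _

namespace BoundQuiver

open Quiver

/-! ### Substitution of arrows in the path algebra -/

namespace PathAlgebra

variable {k : Type u} [Field k] {Q : Type v} [Quiver.{w} Q]

/-- The image of a path under the substitution of `f a` for each arrow `a`. -/
def substPath (f : ∀ {x y : Q}, (x ⟶ y) → PathAlgebra k Q) {x : Q} :
    ∀ {y : Q}, Path x y → PathAlgebra k Q
  | _, Path.nil => ofPath k (Path.nil : Path x x)
  | _, Path.cons p a => substPath f p * f a

theorem nil_mul_ofPath {x y : Q} (p : Path x y) :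
    ofPath k (Path.nil : Path x x) * ofPath k p = ofPath k p := by
  rw [ofPath_mul_ofPath, Path.nil_comp]

theorem ofPath_mul_nil {x y : Q} (p : Path x y) :
    ofPath k p * ofPath k (Path.nil : Path y y) = ofPath k p := by
  rw [ofPath_mul_ofPath, Path.comp_nil]

section Subst

variable {f : ∀ {x y : Q}, (x ⟶ y) → PathAlgebra k Q}

/-- The stationary path in the base case of `substPath` supplies the left idempotent.
Multiplicativity of the substitution therefore needs only a condition on the targets of the `f a`.
-/
theorem nil_mul_substPath {x y : Q} (p : Path x y) :
    ofPath k (Path.nil : Path x x) * substPath f p = substPath f p := by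
  induction p with
  | nil => exact nil_mul_ofPath _
  | cons p a ih => rw [substPath, ← mul_assoc, ih]

theorem substPath_mul_nil
    (hr : ∀ {x y : Q} (a : x ⟶ y), f a * ofPath k (Path.nil : Path y y) = f a)
    {x y : Q} (p : Path x y) :
    substPath f p * ofPath k (Path.nil : Path y y) = substPath f p := by
  cases p with
  | nil => exact nil_mul_ofPath _
  | cons p a => rw [substPath, mul_assoc, hr]

theorem substPath_comp
    (hr : ∀ {x y : Q} (a : x ⟶ y), f a * ofPath k (Path.nil : Path y y) = f a)
    {x y z : Q} (p : Path x y) (q : Path y z) :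
    substPath f (p.comp q) = substPath f p * substPath f q := by
  induction q with
  | nil => exact (substPath_mul_nil hr p).symm
  | cons q a ih => rw [Path.comp_cons, substPath, ih, substPath, mul_assoc]

variable (f) in
/-- The linear endomorphism of `kQ` that substitutes `f a` for each arrow `a`. -/
def substLinear : PathAlgebra k Q →ₗ[k] PathAlgebra k Q :=
  (basis k Q).constr k fun p => substPath f p.2.2

theorem substLinear_ofPath {x y : Q} (p : Path x y) :
    substLinear f (ofPath k p) = substPath f p :=
  (basis k Q).constr_basis k _ (⟨x, y, p⟩ : AnyPath Q)

variable [Fintype Q]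

variable (f) in
/-- The endomorphism of the path algebra that fixes the stationary paths and sends each arrow `a`
to `f a`. -/
def substHom (hr : ∀ {x y : Q} (a : x ⟶ y), f a * ofPath k (Path.nil : Path y y) = f a) :
    PathAlgebra k Q →ₐ[k] PathAlgebra k Q :=
  AlgHom.ofLinearMap (substLinear f)
    (by simp only [one_def, map_sum, substLinear_ofPath, substPath])
    (by
      intro g h
      have key : (mulBilin k Q).compr₂ (substLinear f) =
          (mulBilin k Q).compl₁₂ (substLinear f) (substLinear f) := by
        refine lin_ext fun ⟨x, y, p⟩ => lin_ext fun ⟨x', y', q⟩ => ?_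
        change substLinear f (ofPath k p * ofPath k q) =
          substLinear f (ofPath k p) * substLinear f (ofPath k q)
        by_cases h : y = x'
        · subst h
          rw [ofPath_mul_ofPath]
          simp only [substLinear_ofPath, substPath_comp hr]
        · rw [ofPath_mul_ofPath_of_ne h, map_zero, substLinear_ofPath, substLinear_ofPath,
            ← substPath_mul_nil hr p, ← nil_mul_substPath q, mul_assoc, ← mul_assoc (ofPath k _),
            ofPath_mul_ofPath_of_ne h, zero_mul, mul_zero]
      exact congrArg (fun T => T g h) key)

theorem substHom_nil (hr) (x : Q) :
    substHom f hr (ofPath k (Path.nil : Path x x)) = ofPath k (Path.nil : Path x x) :=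
  substLinear_ofPath _

theorem substHom_arrow (hl : ∀ {x y : Q} (a : x ⟶ y), ofPath k (Path.nil : Path x x) * f a = f a)
    (hr) {x y : Q} (a : x ⟶ y) :
    substHom f hr (ofPath k a.toPath) = f a :=
  (substLinear_ofPath _).trans (hl a)

end Subst

theorem algHom_ext [Fintype Q] {B : Type*} [Ring B] [Algebra k B] {φ ψ : PathAlgebra k Q →ₐ[k] B}
    (h0 : ∀ x : Q, φ (ofPath k (Path.nil : Path x x)) = ψ (ofPath k (Path.nil : Path x x)))
    (h1 : ∀ (x y : Q) (a : x ⟶ y), φ (ofPath k a.toPath) = ψ (ofPath k a.toPath)) : φ = ψ := by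
  refine AlgHom.toLinearMap_injective (lin_ext fun ⟨x, y, p⟩ => ?_)
  change φ (ofPath k p) = ψ (ofPath k p)
  induction p with
  | nil => exact h0 x
  | cons p a ih =>
    rw [← Path.comp_toPath_eq_cons, ← ofPath_mul_ofPath, map_mul, map_mul, ih, h1]

/-! ### The length filtration -/

/-- The span of the paths of length at least `n`. -/
def lengthGE (k : Type u) [Field k] (Q : Type v) [Quiver.{w} Q] (n : ℕ) :
    Submodule k (PathAlgebra k Q) :=
  Submodule.span k {f | ∃ (x y : Q) (p : Path x y), n ≤ p.length ∧ f = ofPath k p}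

theorem mul_mem_lengthGE {m n : ℕ} {f g : PathAlgebra k Q} (hf : f ∈ lengthGE k Q m)
    (hg : g ∈ lengthGE k Q n) : f * g ∈ lengthGE k Q (m + n) := by
  induction hf, hg using Submodule.span_induction₂ with
  | mem_mem f g hf hg =>
    obtain ⟨x, y, p, hp, rfl⟩ := hf
    obtain ⟨x', y', q, hq, rfl⟩ := hg
    by_cases h : y = x'
    · subst h
      rw [ofPath_mul_ofPath]
      exact Submodule.subset_span ⟨_, _, _, by rw [Path.length_comp]; omega, rfl⟩
    · rw [ofPath_mul_ofPath_of_ne h]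
      exact zero_mem _
  | zero_left => rw [zero_mul]; exact zero_mem _
  | zero_right => rw [mul_zero]; exact zero_mem _
  | add_left _ _ _ _ _ _ h1 h2 => rw [add_mul]; exact add_mem h1 h2
  | add_right _ _ _ _ _ _ h1 h2 => rw [mul_add]; exact add_mem h1 h2
  | smul_left r f g _ _ h =>
    have : (r • f) * g = r • (f * g) := by simp [mul_def]
    rw [this]; exact Submodule.smul_mem _ _ h
  | smul_right r f g _ _ h =>
    have : f * (r • g) = r • (f * g) := by simp [mul_def]
    rw [this]; exact Submodule.smul_mem _ _ h

theorem mem_lengthGE_zero (f : PathAlgebra k Q) : f ∈ lengthGE k Q 0 := by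
  have : lengthGE k Q 0 = ⊤ := by
    rw [← top_le_iff, ← (basis k Q).span_eq]
    refine Submodule.span_mono ?_
    rintro _ ⟨⟨x, y, p⟩, rfl⟩
    exact ⟨x, y, p, Nat.zero_le _, rfl⟩
  rw [this]
  trivial

variable [Fintype Q]

/-- The filtration is multiplicative and its zeroth step is everything, so its first step is a
two-sided ideal; it contains the arrows. -/
theorem arrowIdeal_le_lengthGE {f : PathAlgebra k Q} (hf : f ∈ arrowIdeal k Q) :
    f ∈ lengthGE k Q 1 := by
  let J : TwoSidedIdeal (PathAlgebra k Q) := TwoSidedIdeal.mk' (lengthGE k Q 1)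
    (zero_mem _) (add_mem · ·) (neg_mem ·)
    (fun {x y} hy => by simpa using mul_mem_lengthGE (mem_lengthGE_zero x) hy)
    (fun {x y} hx => by simpa using mul_mem_lengthGE hx (mem_lengthGE_zero y))
  have h : arrowIdeal k Q ≤ J := by
    refine TwoSidedIdeal.span_le.2 ?_
    rintro _ ⟨x, y, a, rfl⟩
    refine (TwoSidedIdeal.mem_mk' _ _ _ _ _ _ _).2 ?_
    exact Submodule.subset_span ⟨x, y, a.toPath, le_rfl, rfl⟩
  exact (TwoSidedIdeal.mem_mk' _ _ _ _ _ _ _).1 (h hf)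

theorem arrowIdeal_pow_le_lengthGE (n : ℕ) {f : PathAlgebra k Q}
    (hf : f ∈ (arrowIdeal k Q).asIdeal ^ n) : f ∈ lengthGE k Q n := by
  induction n generalizing f with
  | zero => exact mem_lengthGE_zero f
  | succ n ih =>
    rw [Submodule.pow_succ] at hf
    refine Submodule.mul_induction_on hf (fun g hg h hh => ?_) (fun _ _ h1 h2 => add_mem h1 h2)
    exact mul_mem_lengthGE (ih hg) (arrowIdeal_le_lengthGE (TwoSidedIdeal.mem_asIdeal.1 hh))

end PathAlgebra

/-! ### Group-valued weights and homogeneous ideals -/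

section Weight

variable {Q : Type v} [Quiver.{w} Q] {G : Type*} [Group G]

/-- The weight of a walk, for given weights of the arrows in a group. -/
def walkWeight (ω : ∀ {x y : Q}, (x ⟶ y) → G) {x : Symmetrify Q} :
    ∀ {y : Symmetrify Q}, Walk x y → G
  | _, Path.nil => 1
  | _, Path.cons p (Sum.inl a) => walkWeight ω p * ω a
  | _, Path.cons p (Sum.inr a) => walkWeight ω p * (ω a)⁻¹

variable {ω : ∀ {x y : Q}, (x ⟶ y) → G}

theorem walkWeight_comp {x y z : Symmetrify Q} (p : Walk x y) (q : Walk y z) :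
    walkWeight ω (p.comp q) = walkWeight ω p * walkWeight ω q := by
  induction q with
  | nil => simp [walkWeight]
  | cons q e ih =>
    rcases e with a | a <;> simp [walkWeight, ih, mul_assoc]

theorem walkWeight_cancel {x y : Symmetrify Q} (e : x ⟶ y) :
    walkWeight ω (e.toPath.comp (Quiver.reverse e).toPath) = 1 := by
  rcases e with a | a
  · change 1 * ω a * (ω a)⁻¹ = 1
    simp
  · change 1 * (ω a)⁻¹ * ω a = 1
    simp

theorem walkWeight_reverse {x y : Symmetrify Q} (p : Walk x y) :
    walkWeight ω p.reverse = (walkWeight ω p)⁻¹ := by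
  induction p with
  | nil => simp [walkWeight]
  | cons p e ih =>
    have h : walkWeight ω (Path.cons p e) * walkWeight ω (Path.cons p e).reverse = 1 := by
      rw [Path.reverse, walkWeight_comp, ih, ← Path.comp_toPath_eq_cons, walkWeight_comp]
      have := walkWeight_cancel (ω := ω) e
      rw [walkWeight_comp] at this
      rw [mul_assoc, ← mul_assoc (walkWeight ω e.toPath), this]
      simp
    exact (inv_eq_of_mul_eq_one_right h).symm

open Classical in
/-- The projection of `kQ` onto the span of the paths of weight `g`. -/
def weightProj (k : Type u) [Field k] (ω : ∀ {x y : Q}, (x ⟶ y) → G) (g : G) :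
    PathAlgebra k Q →ₗ[k] PathAlgebra k Q :=
  (PathAlgebra.basis k Q).constr k fun p =>
    if walkWeight ω (toWalk p.2.2) = g then PathAlgebra.of k p else 0

open Classical in
theorem weightProj_ofPath {k : Type u} [Field k] (g : G) {x y : Q} (p : Path x y) :
    weightProj k ω g (PathAlgebra.ofPath k p) =
      if walkWeight ω (toWalk p) = g then PathAlgebra.ofPath k p else 0 :=
  (PathAlgebra.basis k Q).constr_basis k _ (⟨x, y, p⟩ : AnyPath Q)

variable {k : Type u} [Field k] [Fintype Q] {I : TwoSidedIdeal (PathAlgebra k Q)}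

/-- In an ideal that is homogeneous for the weight, all paths of a minimal relation have the same
weight. -/
theorem IsMinimalRelation.walkWeight_eq (hI : ∀ g, ∀ f ∈ I, weightProj k ω g f ∈ I) {x y : Q}
    {S : Finset (Path x y)} {c : Path x y → k} (h : IsMinimalRelation I S c) {p q : Path x y}
    (hp : p ∈ S) (hq : q ∈ S) : walkWeight ω (toWalk p) = walkWeight ω (toWalk q) := by
  classical
  by_contra hne
  -- Projecting the relation to the weight of `q` gives a subsum that contains `q`, omits `p` and
  -- still lies in `I`.
  refine h.minimal (S.filter fun r => walkWeight ω (toWalk r) = walkWeight ω (toWalk q)) ?_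
    ⟨q, by simp [hq]⟩ ?_
  · exact Finset.filter_ssubset.2 ⟨p, hp, hne⟩
  · have := hI (walkWeight ω (toWalk q)) _ h.mem
    simpa [map_sum, weightProj_ofPath, Finset.sum_filter] using this

theorem Homotopic.walkWeight_eq (hI : ∀ g, ∀ f ∈ I, weightProj k ω g f ∈ I)
    {x y : Symmetrify Q} {p q : Walk x y} (h : Homotopic I p q) :
    walkWeight ω p = walkWeight ω q := by
  induction h with
  | refl => rfl
  | symm _ ih => exact ih.symm
  | trans _ _ ih1 ih2 => exact ih1.trans ih2
  | cancel e => exact walkWeight_cancel e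
  | relation h hp hq => exact h.walkWeight_eq hI hp hq
  | comp p r _ ih => simp only [walkWeight_comp, ih]

/-- The homomorphism from the fundamental group induced by a weight for which the ideal is
homogeneous. -/
def weightHom (hI : ∀ g, ∀ f ∈ I, weightProj k ω g f ∈ I) (v₀ : Q) :
    FundamentalGroup I v₀ →* G where
  toFun := Quotient.lift (walkWeight ω) fun _ _ h => Homotopic.walkWeight_eq hI h
  map_one' := rfl
  map_mul' := by
    rintro ⟨p⟩ ⟨q⟩
    exact walkWeight_comp p q

end Weight

/-! ### Differences of paths, and linear spans that are ideals -/

/-- A difference of two different paths in `I` which are not in `I` is a minimal relation, so the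
two paths are homotopic. -/
theorem Homotopic.of_sub_mem {k : Type u} [Field k] {Q : Type v} [Quiver.{w} Q] [Fintype Q]
    {I : TwoSidedIdeal (PathAlgebra k Q)} {x y : Q} {p q : Path x y}
    (h : PathAlgebra.ofPath k p - PathAlgebra.ofPath k q ∈ I)
    (hp : PathAlgebra.ofPath k p ∉ I) :
    Homotopic I (toWalk p) (toWalk q) := by
  classical
  by_cases hpq : p = q
  · subst hpq
    exact Homotopic.refl _
  have hq : PathAlgebra.ofPath k q ∉ I := fun hq => hp (by simpa using I.add_mem h hq)
  refine Homotopic.relation (S := {p, q}) (c := fun r => if r = p then 1 else -1)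
    ⟨?_, ?_, ?_, ?_⟩ (by simp) (by simp)
  · rw [Finset.card_pair hpq]
  · intro r _
    split_ifs <;> simp
  · rw [Finset.sum_pair hpq]
    simpa [Ne.symm hpq, sub_eq_add_neg] using h
  · intro J hJ hne
    obtain ⟨r, hr, hrJ⟩ := Finset.exists_of_ssubset hJ
    -- Removing one element from the pair leaves a singleton, so a smaller subsum would put one of
    -- the two paths into `I`.
    have hsub : J ⊆ ({p, q} : Finset (Path x y)).erase r := Finset.subset_erase.2 ⟨hJ.1, hrJ⟩
    rcases Finset.mem_insert.1 hr with rfl | hr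
    · rw [Finset.erase_insert (by simpa using hpq)] at hsub
      rw [hne.subset_singleton_iff.1 hsub]
      simpa [Ne.symm hpq] using hq
    · obtain rfl := Finset.mem_singleton.1 hr
      rw [Finset.pair_comm, Finset.erase_insert (by simpa using Ne.symm hpq)] at hsub
      rw [hne.subset_singleton_iff.1 hsub]
      simpa using hp

/-- No arrow enters `u`, so the only path ending there is stationary. Hence a path multiplied from
the left either fixes `f` or kills it, and the linear span is already a left ideal. -/
theorem PathAlgebra.mul_mem_span_of_source {k : Type u} [Field k] {Q : Type v} [Quiver.{w} Q]
    {R : Set (PathAlgebra k Q)}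
    (hR : ∀ f ∈ R, ∃ u : Q, (∀ z : Q, IsEmpty (z ⟶ u)) ∧ ofPath k (Path.nil : Path u u) * f = f)
    (g : PathAlgebra k Q) {f : PathAlgebra k Q} (hf : f ∈ Submodule.span k R) :
    g * f ∈ Submodule.span k R := by
  have hle : Submodule.span k R ≤ (Submodule.span k R).comap (mulBilin k Q g) := by
    refine Submodule.span_le.2 fun f hf => ?_
    obtain ⟨u, hu, huf⟩ := hR f hf
    have hg : g ∈ (Submodule.span k R).comap ((mulBilin k Q).flip f) := by
      suffices h : ⊤ ≤ (Submodule.span k R).comap ((mulBilin k Q).flip f) from h trivial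
      rw [← (basis k Q).span_eq, Submodule.span_le]
      rintro _ ⟨⟨x, y, p⟩, rfl⟩
      change ofPath k p * f ∈ Submodule.span k R
      by_cases h : y = u
      · subst h
        cases p with
        | nil =>
          rw [huf]
          exact Submodule.subset_span hf
        | cons p e => exact (hu _).elim e
      · rw [← huf, ← mul_assoc, ofPath_mul_ofPath_of_ne h, zero_mul]
        exact zero_mem _
    exact hg
  exact hle hf

theorem PathAlgebra.mul_mem_span_of_sink {k : Type u} [Field k] {Q : Type v} [Quiver.{w} Q]
    {R : Set (PathAlgebra k Q)}
    (hR : ∀ f ∈ R, ∃ u : Q, (∀ z : Q, IsEmpty (u ⟶ z)) ∧ f * ofPath k (Path.nil : Path u u) = f)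
    (g : PathAlgebra k Q) {f : PathAlgebra k Q} (hf : f ∈ Submodule.span k R) :
    f * g ∈ Submodule.span k R := by
  have hle : Submodule.span k R ≤ (Submodule.span k R).comap ((mulBilin k Q).flip g) := by
    refine Submodule.span_le.2 fun f hf => ?_
    obtain ⟨u, hu, huf⟩ := hR f hf
    have hg : g ∈ (Submodule.span k R).comap (mulBilin k Q f) := by
      suffices h : ⊤ ≤ (Submodule.span k R).comap (mulBilin k Q f) from h trivial
      rw [← (basis k Q).span_eq, Submodule.span_le]
      rintro _ ⟨⟨x, y, p⟩, rfl⟩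
      change f * ofPath k p ∈ Submodule.span k R
      by_cases h : u = x
      · subst h
        have hp : ∀ {z : Q} (p : Path u z), f * ofPath k p ∈ Submodule.span k R := by
          intro z p
          -- Paths grow at their end; the length is used to split off the first arrow, which would
          -- have to leave `u`.
          cases hl : p.length with
          | zero =>
            obtain rfl := Path.eq_of_length_zero p hl
            rw [Path.eq_nil_of_length_zero p hl, huf]
            exact Submodule.subset_span hf
          | succ n =>
            obtain ⟨z', e, -⟩ := Path.eq_toPath_comp_of_length_eq_succ p hl
            exact (hu _).elim e
        exact hp p
      · rw [← huf, mul_assoc, ofPath_mul_ofPath_of_ne h, mul_zero]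
        exact zero_mem _
    exact hg
  exact hle hf

/-! ### The quiver -/

/-- The vertices of the quiver with arrows `a x : source ⟶ middle` and `b x : middle ⟶ sink`
indexed by `Option Y`, and arrows `c y : middle ⟶ tip y` for `y : Y`. -/
inductive Vertex (Y : Type) : Type
  | source : Vertex Y
  | middle : Vertex Y
  | sink : Vertex Y
  | tip (y : Y) : Vertex Y

/-- The arrows between the vertices `Vertex Y`. -/
inductive Arrow (Y : Type) : Vertex Y → Vertex Y → Type
  | a (x : Option Y) : Arrow Y Vertex.source Vertex.middle
  | b (x : Option Y) : Arrow Y Vertex.middle Vertex.sink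
  | c (y : Y) : Arrow Y Vertex.middle (Vertex.tip y)

namespace Vertex

variable {Y : Type}

instance : Quiver (Vertex Y) := ⟨Arrow Y⟩

instance [Finite Y] : Finite (Vertex Y) :=
  Finite.of_surjective (fun x : Option (Option (Option Y)) => match x with
      | none => source
      | some none => middle
      | some (some none) => sink
      | some (some (some y)) => tip y) fun v => by
    cases v with
    | source => exact ⟨none, rfl⟩
    | middle => exact ⟨some none, rfl⟩
    | sink => exact ⟨some (some none), rfl⟩
    | tip y => exact ⟨some (some (some y)), rfl⟩

instance [Fintype Y] : Fintype (Vertex Y) := Fintype.ofFinite _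

/-- The arrow `a x`. -/
def arrowA (x : Option Y) : (source : Vertex Y) ⟶ middle := Arrow.a x

/-- The arrow `b x`. -/
def arrowB (x : Option Y) : (middle : Vertex Y) ⟶ sink := Arrow.b x

/-- The arrow `c y`. -/
def arrowC (y : Y) : (middle : Vertex Y) ⟶ tip y := Arrow.c y

theorem isEmpty_hom_source (z : Vertex Y) : IsEmpty (z ⟶ source) := ⟨fun e => nomatch e⟩

theorem isEmpty_sink_hom (z : Vertex Y) : IsEmpty (sink ⟶ z) := ⟨fun e => nomatch e⟩

theorem isEmpty_tip_hom (y : Y) (z : Vertex Y) : IsEmpty (tip y ⟶ z) := ⟨fun e => nomatch e⟩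

theorem isFiniteQuiver [Finite Y] : IsFiniteQuiver (Vertex Y) := by
  refine ⟨inferInstance, fun x y => ?_⟩
  -- Fixed end points determine the constructor, and for `Arrow.c y` also `y`, so the overlapping
  -- codes do no harm.
  refine Finite.of_injective (β := Option (Option Y ⊕ Y)) (fun e : Arrow Y x y => match e with
    | Arrow.a x => some (Sum.inl x)
    | Arrow.b x => some (Sum.inl x)
    | Arrow.c y => none) ?_
  intro e e' h
  rcases e with x | x | y <;> rcases e' with x' | x' | y' <;> simp_all

/-- A nonstationary path is determined by its last arrow and the path before it, which allows
finiteness to be propagated from the source to the later vertices. -/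
theorem finite_path_of_finite {Q : Type v} [Quiver.{w} Q] (hQ : IsFiniteQuiver Q) {x y : Q}
    (h : ∀ z : Q, Nonempty (z ⟶ y) → Finite (Path x z)) : Finite (Path x y) := by
  have := hQ.1
  have := fun z => hQ.2 z y
  have hfin : ∀ z, Finite (Path x z × (z ⟶ y)) := fun z => by
    rcases isEmpty_or_nonempty (z ⟶ y) with hz | hz
    · infer_instance
    · have := h z hz
      infer_instance
  refine Finite.of_injective (β := Option (Σ z : Q, Path x z × (z ⟶ y)))
    (fun p => match p with
      | Path.nil => none
      | Path.cons p e => some ⟨_, p, e⟩) ?_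
  intro p q h
  cases p <;> cases q <;> simp only [reduceCtorEq, Option.some.injEq] at h
  · rfl
  · cases h
    rfl

instance finite_path [Finite Y] (x y : Vertex Y) : Finite (Path x y) := by
  have hs : Finite (Path x source) :=
    finite_path_of_finite isFiniteQuiver fun z ⟨e⟩ => (isEmpty_hom_source z).elim e
  have hm : Finite (Path x middle) :=
    finite_path_of_finite isFiniteQuiver fun z ⟨e⟩ => by obtain ⟨⟩ := e; exact hs
  cases y with
  | source => exact hs
  | middle => exact hm
  | sink => exact finite_path_of_finite isFiniteQuiver fun z ⟨e⟩ => by obtain ⟨⟩ := e; exact hm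
  | tip y => exact finite_path_of_finite isFiniteQuiver fun z ⟨e⟩ => by obtain ⟨⟩ := e; exact hm

/-- The distance of a vertex from the source. -/
def level : Vertex Y → ℕ
  | source => 0
  | middle => 1
  | sink => 2
  | tip _ => 2

theorem level_add_length {x y : Vertex Y} (p : Path x y) : level x + p.length = level y := by
  induction p with
  | nil => rfl
  | cons p e ih =>
    rw [Path.length_cons, ← add_assoc, ih]
    rcases e <;> rfl

theorem length_le_two {x y : Vertex Y} (p : Path x y) : p.length ≤ 2 := by
  have h := level_add_length p
  have : level y ≤ 2 := by cases y <;> simp [level]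
  omega

/-- A walk from the source to each vertex, through the arrows `a none`, `b none` and `c y`. -/
def treeWalk : ∀ v : Vertex Y, Walk (Q := Vertex Y) (Symmetrify.of.obj source) (Symmetrify.of.obj v)
  | source => Path.nil
  | middle => toWalk (arrowA none).toPath
  | sink => toWalk ((arrowA none).toPath.comp (arrowB none).toPath)
  | tip y => toWalk ((arrowA none).toPath.comp (arrowC y).toPath)

theorem isConnectedQuiver : IsConnectedQuiver (Vertex Y) :=
  ⟨⟨source⟩, fun x y => ⟨(treeWalk x).reverse.comp (treeWalk y)⟩⟩

end Vertex

/-! ### The relators and the ideal they generate -/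

namespace Vertex

open PathAlgebra

variable {k : Type u} [Field k] {Y : Type}

/-- The path `a x` followed by `b y`. -/
def pathAB (x y : Option Y) : Path (source : Vertex Y) sink :=
  (arrowA x).toPath.comp (arrowB y).toPath

/-- The path `a x` followed by `c y`. -/
def pathAC (x : Option Y) (y : Y) : Path (source : Vertex Y) (tip y) :=
  (arrowA x).toPath.comp (arrowC y).toPath

/-- The element `a x - c x • a none` of the path algebra, where `c none = 0`. -/
def shiftA (c : Y → k) (x : Option Y) : PathAlgebra k (Vertex Y) :=
  ofPath k (arrowA x).toPath - x.elim 0 c • ofPath k (arrowA none).toPath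

/-- The element `b x - c x • b none` of the path algebra, where `c none = 0`. -/
def shiftB (c : Y → k) (x : Option Y) : PathAlgebra k (Vertex Y) :=
  ofPath k (arrowB x).toPath - x.elim 0 c • ofPath k (arrowB none).toPath

theorem shiftA_none (c : Y → k) : shiftA c none = ofPath k (arrowA none).toPath := by
  simp [shiftA]

theorem shiftB_none (c : Y → k) : shiftB c none = ofPath k (arrowB none).toPath := by
  simp [shiftB]

theorem smul_mul_left (r : k) (f g : PathAlgebra k (Vertex Y)) : (r • f) * g = r • (f * g) := by
  simp [mul_def]

theorem smul_mul_right (r : k) (f g : PathAlgebra k (Vertex Y)) : f * (r • g) = r • (f * g) := by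
  simp [mul_def]

theorem shiftA_mul_shiftB (c : Y → k) (x y : Option Y) :
    shiftA c x * shiftB c y = ofPath k (pathAB x y) - x.elim 0 c • ofPath k (pathAB none y) -
      (y.elim 0 c • ofPath k (pathAB x none) -
        x.elim 0 c • y.elim 0 c • ofPath k (pathAB none none)) := by
  simp only [shiftA, shiftB, sub_mul, mul_sub, smul_mul_left, smul_mul_right, ofPath_mul_ofPath,
    pathAB]
  rw [smul_comm (x.elim 0 c)]

theorem shiftA_mul_arrowC (c : Y → k) (x : Option Y) (y : Y) :
    shiftA c x * ofPath k (arrowC y).toPath =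
      ofPath k (pathAC x y) - x.elim 0 c • ofPath k (pathAC none y) := by
  simp only [shiftA, sub_mul, smul_mul_left, ofPath_mul_ofPath, pathAC]

/-- The generators of the ideal attached to the triples `T` and the shift `c`: they express that
`a y` and `b y` represent the same element, that the product of `x` and `y` is `z` for `T x y z`,
and that `a y` followed by `c y` vanishes, all in the shifted arrows. -/
inductive IsRelator (T : Y → Y → Y → Prop) (c : Y → k) : PathAlgebra k (Vertex Y) → Prop
  | comm (y : Y) :
      IsRelator T c (shiftA c (some y) * shiftB c none - shiftA c none * shiftB c (some y))
  | mul {x y z : Y} (h : T x y z) :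
      IsRelator T c
        (shiftA c (some x) * shiftB c (some y) - shiftA c (some z) * shiftB c none)
  | tip (y : Y) : IsRelator T c (shiftA c (some y) * ofPath k (arrowC y).toPath)

variable {T : Y → Y → Y → Prop} {c : Y → k}

theorem nil_mul_shiftA (x : Option Y) :
    ofPath k (Path.nil : Path (source : Vertex Y) source) * shiftA c x = shiftA c x := by
  simp only [shiftA, mul_sub, smul_mul_right, nil_mul_ofPath]

theorem nil_mul_shiftB (x : Option Y) :
    ofPath k (Path.nil : Path (middle : Vertex Y) middle) * shiftB c x = shiftB c x := by
  simp only [shiftB, mul_sub, smul_mul_right, nil_mul_ofPath]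

theorem shiftA_mul_nil (x : Option Y) :
    shiftA c x * ofPath k (Path.nil : Path (middle : Vertex Y) middle) = shiftA c x := by
  simp only [shiftA, sub_mul, smul_mul_left, ofPath_mul_nil]

theorem shiftB_mul_nil (x : Option Y) :
    shiftB c x * ofPath k (Path.nil : Path (sink : Vertex Y) sink) = shiftB c x := by
  simp only [shiftB, sub_mul, smul_mul_left, ofPath_mul_nil]

theorem IsRelator.exists_source {f : PathAlgebra k (Vertex Y)} (h : IsRelator T c f) :
    ∃ u : Vertex Y, (∀ z, IsEmpty (z ⟶ u)) ∧ ofPath k (Path.nil : Path u u) * f = f := by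
  refine ⟨source, isEmpty_hom_source, ?_⟩
  cases h <;> simp only [mul_sub, ← mul_assoc, nil_mul_shiftA]

theorem IsRelator.exists_sink {f : PathAlgebra k (Vertex Y)} (h : IsRelator T c f) :
    ∃ u : Vertex Y, (∀ z, IsEmpty (u ⟶ z)) ∧ f * ofPath k (Path.nil : Path u u) = f := by
  cases h with
  | comm y => exact ⟨sink, isEmpty_sink_hom, by simp only [sub_mul, mul_assoc, shiftB_mul_nil]⟩
  | mul h => exact ⟨sink, isEmpty_sink_hom, by simp only [sub_mul, mul_assoc, shiftB_mul_nil]⟩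
  | tip y => exact ⟨Vertex.tip y, isEmpty_tip_hom y, by rw [mul_assoc, ofPath_mul_nil]⟩

/-- The image of an arrow under the shift by `c`. -/
def shiftArrow (c : Y → k) : ∀ {x y : Vertex Y}, (x ⟶ y) → PathAlgebra k (Vertex Y)
  | _, _, Arrow.a x => shiftA c x
  | _, _, Arrow.b x => shiftB c x
  | _, _, Arrow.c y => ofPath k (arrowC y).toPath

theorem nil_mul_shiftArrow {x y : Vertex Y} (e : x ⟶ y) :
    ofPath k (Path.nil : Path x x) * shiftArrow c e = shiftArrow c e := by
  rcases e with x | x | y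
  · exact nil_mul_shiftA x
  · exact nil_mul_shiftB x
  · exact nil_mul_ofPath _

theorem shiftArrow_mul_nil {x y : Vertex Y} (e : x ⟶ y) :
    shiftArrow c e * ofPath k (Path.nil : Path y y) = shiftArrow c e := by
  rcases e with x | x | y
  · exact shiftA_mul_nil x
  · exact shiftB_mul_nil x
  · exact ofPath_mul_nil _

variable [Fintype Y]

variable (T c) in
/-- The two-sided ideal generated by the relators; it is also their linear span. -/
def relatorIdeal : TwoSidedIdeal (PathAlgebra k (Vertex Y)) :=
  TwoSidedIdeal.mk' (Submodule.span k {f | IsRelator T c f})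
    (zero_mem _) (add_mem · ·) (neg_mem ·)
    (fun hy => mul_mem_span_of_source (fun _ hf => IsRelator.exists_source hf) _ hy)
    (fun hx => mul_mem_span_of_sink (fun _ hf => IsRelator.exists_sink hf) _ hx)

theorem mem_relatorIdeal {f : PathAlgebra k (Vertex Y)} :
    f ∈ relatorIdeal T c ↔ f ∈ Submodule.span k {f | IsRelator T c f} :=
  TwoSidedIdeal.mem_mk' _ _ _ _ _ _ _

theorem IsRelator.mem {f : PathAlgebra k (Vertex Y)} (h : IsRelator T c f) :
    f ∈ relatorIdeal T c :=
  mem_relatorIdeal.2 (Submodule.subset_span h)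

theorem arrow_mem_arrowIdeal {x y : Vertex Y} (e : x ⟶ y) :
    ofPath k e.toPath ∈ (arrowIdeal k (Vertex Y)).asIdeal :=
  TwoSidedIdeal.mem_asIdeal.2 (TwoSidedIdeal.subset_span ⟨x, y, e, rfl⟩)

theorem smul_mem_ideal (J : Ideal (PathAlgebra k (Vertex Y))) (r : k)
    {f : PathAlgebra k (Vertex Y)} (hf : f ∈ J) : r • f ∈ J := by
  rw [Algebra.smul_def]
  exact J.mul_mem_left _ hf

theorem shiftA_mem_arrowIdeal (x : Option Y) :
    shiftA c x ∈ (arrowIdeal k (Vertex Y)).asIdeal :=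
  sub_mem (arrow_mem_arrowIdeal _) (smul_mem_ideal _ _ (arrow_mem_arrowIdeal _))

theorem shiftB_mem_arrowIdeal (x : Option Y) :
    shiftB c x ∈ (arrowIdeal k (Vertex Y)).asIdeal :=
  sub_mem (arrow_mem_arrowIdeal _) (smul_mem_ideal _ _ (arrow_mem_arrowIdeal _))

theorem mul_mem_arrowIdeal_sq {f g : PathAlgebra k (Vertex Y)}
    (hf : f ∈ (arrowIdeal k (Vertex Y)).asIdeal) (hg : g ∈ (arrowIdeal k (Vertex Y)).asIdeal) :
    f * g ∈ (arrowIdeal k (Vertex Y)).asIdeal ^ 2 := by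
  rw [Submodule.pow_succ, Submodule.pow_one]
  exact Submodule.mul_mem_mul hf hg

/-- All paths have length at most two, so `F ^ 3 = 0`; every relator is built from products of two
elements of `F`. -/
theorem isAdmissible_relatorIdeal : IsAdmissible (relatorIdeal T c) := by
  refine ⟨3, by norm_num, fun f hf => ?_, fun f hf => ?_⟩
  · have h0 : lengthGE k (Vertex Y) 3 = ⊥ := by
      refine le_bot_iff.1 (Submodule.span_le.2 ?_)
      rintro _ ⟨x, y, p, hp, rfl⟩
      have := length_le_two p
      omega
    have hf := arrowIdeal_pow_le_lengthGE 3 hf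
    rw [h0, Submodule.mem_bot] at hf
    rw [hf]
    exact zero_mem _
  · replace hf := mem_relatorIdeal.1 (TwoSidedIdeal.mem_asIdeal.1 hf)
    induction hf using Submodule.span_induction with
    | mem f hf =>
      cases hf with
      | comm y =>
        exact sub_mem (mul_mem_arrowIdeal_sq (shiftA_mem_arrowIdeal _) (shiftB_mem_arrowIdeal _))
          (mul_mem_arrowIdeal_sq (shiftA_mem_arrowIdeal _) (shiftB_mem_arrowIdeal _))
      | mul h =>
        exact sub_mem (mul_mem_arrowIdeal_sq (shiftA_mem_arrowIdeal _) (shiftB_mem_arrowIdeal _))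
          (mul_mem_arrowIdeal_sq (shiftA_mem_arrowIdeal _) (shiftB_mem_arrowIdeal _))
      | tip y =>
        exact mul_mem_arrowIdeal_sq (shiftA_mem_arrowIdeal _) (arrow_mem_arrowIdeal _)
    | zero => exact zero_mem _
    | add f g _ _ hf hg => exact add_mem hf hg
    | smul r f _ hf => exact smul_mem_ideal _ r hf

/-! ### The automorphism that shifts the arrows -/

variable (c) in
/-- The endomorphism of the path algebra that sends each arrow to its shift by `c`. -/
def shiftHom : PathAlgebra k (Vertex Y) →ₐ[k] PathAlgebra k (Vertex Y) :=
  substHom (shiftArrow c) shiftArrow_mul_nil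

theorem shiftHom_arrow {x y : Vertex Y} (e : x ⟶ y) :
    shiftHom c (ofPath k e.toPath) = shiftArrow c e :=
  substHom_arrow nil_mul_shiftArrow shiftArrow_mul_nil e

/-- Every shift fixes `a none`, so shifts compose by adding their parameters. -/
theorem shiftHom_shiftA (c d : Y → k) (x : Option Y) :
    shiftHom c (shiftA d x) = shiftA (c + d) x := by
  have h : ∀ x, shiftHom c (ofPath k (arrowA x).toPath) = shiftA c x := fun _ => shiftHom_arrow _
  rw [shiftA, map_sub, map_smul, h, h, shiftA_none, shiftA, shiftA]
  cases x <;> simp [add_smul, sub_sub]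

theorem shiftHom_shiftB (c d : Y → k) (x : Option Y) :
    shiftHom c (shiftB d x) = shiftB (c + d) x := by
  have h : ∀ x, shiftHom c (ofPath k (arrowB x).toPath) = shiftB c x := fun _ => shiftHom_arrow _
  rw [shiftB, map_sub, map_smul, h, h, shiftB_none, shiftB, shiftB]
  cases x <;> simp [add_smul, sub_sub]

theorem shiftA_zero (x : Option Y) :
    shiftA (0 : Y → k) x = ofPath k (arrowA x).toPath := by
  cases x <;> simp [shiftA]

theorem shiftB_zero (x : Option Y) :
    shiftB (0 : Y → k) x = ofPath k (arrowB x).toPath := by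
  cases x <;> simp [shiftB]

theorem shiftHom_arrowC (y : Y) :
    shiftHom c (ofPath k (arrowC y).toPath) = ofPath k (arrowC y).toPath :=
  shiftHom_arrow _

theorem shiftHom_comp_of_add_eq_zero {c d : Y → k} (h : c + d = 0) :
    (shiftHom c).comp (shiftHom d) = AlgHom.id k _ := by
  refine algHom_ext (fun x => ?_) fun x y e => ?_
  · simp only [AlgHom.comp_apply, shiftHom, substHom_nil, AlgHom.id_apply]
  · rw [AlgHom.comp_apply, shiftHom_arrow, AlgHom.id_apply]
    rcases e with x | x | y
    · exact (shiftHom_shiftA c d x).trans (h ▸ shiftA_zero x)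
    · exact (shiftHom_shiftB c d x).trans (h ▸ shiftB_zero x)
    · exact shiftHom_arrowC y

variable (c) in
/-- The automorphism of the path algebra that sends each arrow to its shift by `c`. -/
def shiftEquiv : PathAlgebra k (Vertex Y) ≃ₐ[k] PathAlgebra k (Vertex Y) :=
  AlgEquiv.ofAlgHom (shiftHom c) (shiftHom (-c))
    (shiftHom_comp_of_add_eq_zero (add_neg_cancel c))
    (shiftHom_comp_of_add_eq_zero (neg_add_cancel c))

theorem IsRelator.shiftHom {d : Y → k} {f : PathAlgebra k (Vertex Y)} (h : IsRelator T d f) :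
    IsRelator T (c + d) (shiftHom c f) := by
  cases h with
  | comm y =>
    simp only [map_sub, map_mul, shiftHom_shiftA, shiftHom_shiftB]
    exact .comm y
  | mul h =>
    simp only [map_sub, map_mul, shiftHom_shiftA, shiftHom_shiftB]
    exact .mul h
  | tip y =>
    simp only [map_mul, shiftHom_shiftA, shiftHom_arrowC]
    exact .tip y

theorem shiftHom_mem_relatorIdeal {d : Y → k} {f : PathAlgebra k (Vertex Y)}
    (h : f ∈ relatorIdeal T d) : Vertex.shiftHom c f ∈ relatorIdeal T (c + d) := by
  rw [mem_relatorIdeal] at h ⊢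
  have hle : Submodule.span k {f | IsRelator T d f} ≤
      (Submodule.span k {f | IsRelator T (c + d) f}).comap (Vertex.shiftHom c).toLinearMap :=
    Submodule.span_le.2 fun f hf => Submodule.subset_span (IsRelator.shiftHom hf)
  exact hle h

/-- All the ideals with a given `T` lie in one orbit of automorphisms of the path algebra. This is
what gives every shift the same quotient algebra. -/
theorem relatorIdeal_eq_map_shiftEquiv (T : Y → Y → Y → Prop) (c : Y → k) :
    (relatorIdeal T c).asIdeal =
      (relatorIdeal T 0).asIdeal.map
        (shiftEquiv c : PathAlgebra k (Vertex Y) →+* PathAlgebra k (Vertex Y)) := by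
  refine le_antisymm (fun f hf => ?_) (Ideal.map_le_iff_le_comap.2 fun f hf => ?_)
  · have h1 := shiftHom_mem_relatorIdeal (c := -c) (TwoSidedIdeal.mem_asIdeal.1 hf)
    rw [neg_add_cancel] at h1
    have h2 := Ideal.mem_map_of_mem
      (shiftEquiv c : PathAlgebra k (Vertex Y) →+* PathAlgebra k (Vertex Y))
      (TwoSidedIdeal.mem_asIdeal.2 h1)
    rwa [show (shiftEquiv c : PathAlgebra k (Vertex Y) →+* PathAlgebra k (Vertex Y))
        (Vertex.shiftHom (-c) f) = f from
      (shiftEquiv c).apply_symm_apply f] at h2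
  · have h1 := shiftHom_mem_relatorIdeal (c := c) (TwoSidedIdeal.mem_asIdeal.1 hf)
    rw [add_zero] at h1
    exact TwoSidedIdeal.mem_asIdeal.2 h1

variable (T) in
theorem isPresentation_relatorIdeal (c : Y → k) :
    IsPresentation (PathAlgebra k (Vertex Y) ⧸ (relatorIdeal (k := k) T 0).asIdeal)
      (relatorIdeal T c) where
  finite := isFiniteQuiver
  connected := isConnectedQuiver
  admissible := isAdmissible_relatorIdeal
  iso := ⟨Ideal.quotientEquivAlg _ _ (shiftEquiv c) (relatorIdeal_eq_map_shiftEquiv T c)⟩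

theorem finiteDimensional_quotient (I : TwoSidedIdeal (PathAlgebra k (Vertex Y))) :
    FiniteDimensional k (PathAlgebra k (Vertex Y) ⧸ I.asIdeal) := by
  have : FiniteDimensional k (PathAlgebra k (Vertex Y)) :=
    (basis k (Vertex Y)).finiteDimensional_of_finite
  exact Module.Finite.of_surjective (Ideal.Quotient.mkₐ k I.asIdeal).toLinearMap
    (Ideal.Quotient.mkₐ_surjective k I.asIdeal)

end Vertex

/-! ### Conjugation of walks -/

section Conjugation

variable {k : Type u} [Field k] {Q : Type v} [Quiver.{w} Q] [Fintype Q]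
  {I : TwoSidedIdeal (PathAlgebra k Q)} {s x y z : Symmetrify Q}

theorem Homotopic.conj_comp_conj (t : Walk s x) (u : Walk s y) (r : Walk s z) (p : Walk x y)
    (q : Walk y z) :
    Homotopic I (((t.comp p).comp u.reverse).comp ((u.comp q).comp r.reverse))
      ((t.comp (p.comp q)).comp r.reverse) := by
  have h := Homotopic.comp (t.comp p) (q.comp r.reverse) (Homotopic.reverse_comp (I := I) u)
  simpa only [Path.comp_assoc, Path.nil_comp] using h

theorem Homotopic.nil_of_conj (t : Walk s x) {p : Walk x x}
    (h : Homotopic I ((t.comp p).comp t.reverse) Path.nil) : Homotopic I p Path.nil := by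
  have h1 := Homotopic.comp t.reverse t h
  have h2 := Homotopic.comp_right (Homotopic.reverse_comp (I := I) t)
    (p.comp (t.reverse.comp t))
  have h3 := Homotopic.comp_left p (Homotopic.reverse_comp (I := I) t)
  simp only [Path.comp_assoc, Path.nil_comp, Path.comp_nil] at h1 h2 h3
  exact (h3.symm.trans h2.symm).trans (h1.trans (Homotopic.reverse_comp t))

end Conjugation

namespace Vertex

open PathAlgebra

variable {k : Type u} [Field k] {Y : Type} {T : Y → Y → Y → Prop} {c : Y → k}

/-! ### The weight of an arrow -/

section Weight

variable {G : Type v} [Group G] {β : Y → G}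

/-- The weight of the arrows: `a y` and `b y` have the weight `β y`, and the arrows `a none`,
`b none` and `c y` have the weight `1`. -/
def arrowWeight (β : Y → G) : ∀ {x y : Vertex Y}, (x ⟶ y) → G
  | _, _, Arrow.a x => x.elim 1 β
  | _, _, Arrow.b x => x.elim 1 β
  | _, _, Arrow.c _ => 1

theorem walkWeight_pathAB (x y : Option Y) :
    walkWeight (arrowWeight β) (toWalk (pathAB x y)) = x.elim 1 β * y.elim 1 β := by
  change 1 * x.elim 1 β * y.elim 1 β = _
  rw [one_mul]

theorem walkWeight_pathAC (x : Option Y) (y : Y) :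
    walkWeight (arrowWeight β) (toWalk (pathAC x y)) = x.elim 1 β := by
  change 1 * x.elim 1 β * 1 = _
  rw [one_mul, mul_one]

/-- Trivial weights along the tree mean that moving a closed walk to another base point does not
change its weight. -/
theorem walkWeight_treeWalk (x : Vertex Y) :
    walkWeight (arrowWeight β) (treeWalk x) = 1 := by
  cases x with
  | source => rfl
  | middle => exact mul_one (1 : G)
  | sink => exact (walkWeight_pathAB none none).trans (mul_one (1 : G))
  | tip y => exact walkWeight_pathAC none y

theorem elim_eq_zero_or (hβ : ∀ y, c y = 0 ∨ β y = 1) (x : Option Y) :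
    x.elim 0 c = 0 ∨ x.elim 1 β = 1 := by
  cases x with
  | none => exact Or.inl rfl
  | some y => exact hβ y

-- The product is homogeneous even though it is a combination of several paths. If the shift at `x`
-- is nonzero, then `β x = 1`, so `a x` and `a none` have the same weight; likewise for `b`.
open Classical in
theorem weightProj_shiftA_mul_shiftB (hβ : ∀ y, c y = 0 ∨ β y = 1) (g : G) (x y : Option Y) :
    weightProj k (arrowWeight β) g (shiftA c x * shiftB c y) =
      if x.elim 1 β * y.elim 1 β = g then shiftA c x * shiftB c y else 0 := by
  rw [shiftA_mul_shiftB]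
  simp only [map_sub, map_smul, weightProj_ofPath, walkWeight_pathAB]
  rcases elim_eq_zero_or hβ x with hx | hx <;> rcases elim_eq_zero_or hβ y with hy | hy <;>
    simp only [hx, hy, Option.elim_none, one_mul, mul_one, zero_smul, smul_zero, sub_zero] <;>
      split_ifs <;> simp

open Classical in
theorem weightProj_shiftA_mul_arrowC (hβ : ∀ y, c y = 0 ∨ β y = 1) (g : G) (x : Option Y)
    (y : Y) :
    weightProj k (arrowWeight β) g (shiftA c x * ofPath k (arrowC y).toPath) =
      if x.elim 1 β = g then shiftA c x * ofPath k (arrowC y).toPath else 0 := by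
  rw [shiftA_mul_arrowC]
  simp only [map_sub, map_smul, weightProj_ofPath, walkWeight_pathAC]
  rcases elim_eq_zero_or hβ x with hx | hx <;>
    simp only [hx, Option.elim_none, zero_smul, sub_zero] <;>
    split_ifs with h <;> simp [h]

theorem weightProj_mem_relatorIdeal [Fintype Y] (hβ : ∀ y, c y = 0 ∨ β y = 1)
    (hT : ∀ x y z, T x y z → β x * β y = β z) (g : G) (f : PathAlgebra k (Vertex Y))
    (hf : f ∈ relatorIdeal T c) : weightProj k (arrowWeight β) g f ∈ relatorIdeal T c := by
  classical
  rw [mem_relatorIdeal] at hf ⊢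
  suffices hle : Submodule.span k {f | IsRelator T c f} ≤
      (Submodule.span k {f | IsRelator T c f}).comap (weightProj k (arrowWeight β) g) from hle hf
  refine Submodule.span_le.2 fun f hf => ?_
  -- Each relator is homogeneous; for the products this is the equation `β x * β y = β z`.
  suffices h : weightProj k (arrowWeight β) g f = f ∨ weightProj k (arrowWeight β) g f = 0 by
    rw [SetLike.mem_coe, Submodule.mem_comap]
    rcases h with h | h <;> rw [h]
    · exact Submodule.subset_span hf
    · exact zero_mem _
  rcases hf with y | h | y
  · simp only [map_sub, weightProj_shiftA_mul_shiftB hβ, Option.elim_some, Option.elim_none,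
      mul_one, one_mul]
    split_ifs <;> simp
  · simp only [map_sub, weightProj_shiftA_mul_shiftB hβ, Option.elim_some, Option.elim_none,
      mul_one, hT _ _ _ h]
    split_ifs <;> simp
  · rw [weightProj_shiftA_mul_arrowC hβ]
    split_ifs <;> simp

end Weight

/-! ### The augmentation -/

/-- The value of the augmentation at a path that ends at a given vertex. -/
def augmentValue (c : Y → k) : Vertex Y → k
  | source => 0
  | middle => 0
  | sink => 1
  | tip y => c y

variable (c) in
/-- The functional that gives all paths to `sink` the value `1` and all paths to `tip y` the
value `c y`. -/
def augment : PathAlgebra k (Vertex Y) →ₗ[k] k :=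
  (basis k (Vertex Y)).constr k fun p => augmentValue c p.2.1

theorem augment_ofPath {x y : Vertex Y} (p : Path x y) :
    augment c (ofPath k p) = augmentValue c y :=
  (basis k (Vertex Y)).constr_basis k _ (⟨x, y, p⟩ : AnyPath (Vertex Y))

theorem augment_shiftA_mul_shiftB (x y : Option Y) :
    augment c (shiftA c x * shiftB c y) = (1 - x.elim 0 c) * (1 - y.elim 0 c) := by
  rw [shiftA_mul_shiftB]
  simp only [map_sub, map_smul, augment_ofPath, augmentValue, smul_eq_mul]
  ring

theorem augment_shiftA_mul_arrowC (x : Option Y) (y : Y) :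
    augment c (shiftA c x * ofPath k (arrowC y).toPath) = (1 - x.elim 0 c) * c y := by
  rw [shiftA_mul_arrowC]
  simp only [map_sub, map_smul, augment_ofPath, augmentValue, smul_eq_mul]
  ring

variable [Fintype Y]

/-- On the relators the functional takes the values `(1 - c y) - (1 - c y)`, `(1 - c z) ^ 2 - (1 - c
z)` and `(1 - c y) * c y`, which vanish for `c` with values in `{0, 1}`. Consequently no single path
to `sink`, or to `tip y` with `c y = 1`, lies in the ideal. -/
theorem augment_eq_zero_of_mem (hc : ∀ y, c y = 0 ∨ c y = 1)
    (hT : ∀ x y z, T x y z → c x = c z ∧ c y = c z) {f : PathAlgebra k (Vertex Y)}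
    (hf : f ∈ relatorIdeal T c) : augment c f = 0 := by
  rw [mem_relatorIdeal] at hf
  suffices hle : Submodule.span k {f | IsRelator T c f} ≤ LinearMap.ker (augment c) from hle hf
  refine Submodule.span_le.2 fun f hf => ?_
  rw [SetLike.mem_coe, LinearMap.mem_ker]
  rcases hf with y | @⟨x, y, z, h⟩ | y
  · simp [augment_shiftA_mul_shiftB]
  · simp only [map_sub, augment_shiftA_mul_shiftB, Option.elim_some, Option.elim_none, hT _ _ _ h]
    rcases hc z with h | h <;> simp [h]
  · rw [augment_shiftA_mul_arrowC]
    rcases hc y with h | h <;> simp [h]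

/-! ### Homotopies -/

theorem homotopic_of_sub_mem (hc : ∀ y, c y = 0 ∨ c y = 1)
    (hT : ∀ x y z, T x y z → c x = c z ∧ c y = c z) {y : Vertex Y}
    (hy : augmentValue c y = 1) {p q : Path source y}
    (h : ofPath k p - ofPath k q ∈ relatorIdeal T c) :
    Homotopic (relatorIdeal T c) (toWalk p) (toWalk q) := by
  refine Homotopic.of_sub_mem h fun hp => ?_
  have := augment_eq_zero_of_mem hc hT hp
  rw [augment_ofPath, hy] at this
  exact one_ne_zero this

/-- The multiples of `a none * b none` cancel, so this relator is a difference of two paths for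
every shift. -/
theorem homotopic_comm (hc : ∀ y, c y = 0 ∨ c y = 1)
    (hT : ∀ x y z, T x y z → c x = c z ∧ c y = c z) (y : Y) : Homotopic (relatorIdeal T c)
    (toWalk (pathAB (some y) none)) (toWalk (pathAB none (some y))) := by
  refine homotopic_of_sub_mem hc hT rfl ?_
  have := (IsRelator.comm (T := T) (c := c) y).mem
  simpa [shiftA_mul_shiftB] using this

/-- By `hT` the shift vanishes at `x` and `y` as well, so the relator is a difference of two paths.
-/
theorem homotopic_mul (hc : ∀ y, c y = 0 ∨ c y = 1)
    (hT : ∀ x y z, T x y z → c x = c z ∧ c y = c z) {x y z : Y} (h : T x y z) (hz : c z = 0) :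
    Homotopic (relatorIdeal T c) (toWalk (pathAB (some x) (some y))) (toWalk (pathAB (some z) none)) := by
  refine homotopic_of_sub_mem hc hT rfl ?_
  have := (IsRelator.mul (c := c) h).mem
  simpa [shiftA_mul_shiftB, hz, hT _ _ _ h] using this

/-- This is the switch: the relator is a difference of two paths when `c y = 1`, but a single path
when `c y = 0`. -/
theorem homotopic_tip (hc : ∀ y, c y = 0 ∨ c y = 1)
    (hT : ∀ x y z, T x y z → c x = c z ∧ c y = c z) {y : Y} (hy : c y = 1) :
    Homotopic (relatorIdeal T c) (toWalk (pathAC (some y) y)) (toWalk (pathAC none y)) := by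
  refine homotopic_of_sub_mem (y := Vertex.tip y) hc hT hy ?_
  have := (IsRelator.tip (T := T) (c := c) y).mem
  simpa [shiftA_mul_arrowC, hy] using this

/-! ### The fundamental group -/

variable {I : TwoSidedIdeal (PathAlgebra k (Vertex Y))}

variable (I) in
/-- The class in the fundamental group at the source of the closed walk obtained from a walk by
joining its end points to the source. -/
def walkClass {x y : Symmetrify (Vertex Y)} (p : Walk x y) : FundamentalGroup I source :=
  Quotient.mk (homotopySetoid I (Symmetrify.of.obj source))
    (((treeWalk x).comp p).comp (treeWalk y).reverse)

theorem walkClass_eq_of_homotopic {x y : Symmetrify (Vertex Y)} {p q : Walk x y}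
    (h : Homotopic I p q) : walkClass I p = walkClass I q :=
  Quotient.sound (s := homotopySetoid I (Symmetrify.of.obj source))
    (Homotopic.comp (treeWalk x) (treeWalk y).reverse h)

theorem walkClass_nil (x : Symmetrify (Vertex Y)) : walkClass I (Path.nil : Walk x x) = 1 :=
  Quotient.sound (s := homotopySetoid I (Symmetrify.of.obj source))
    (Homotopic.comp_reverse (treeWalk x))

theorem walkClass_comp {x y z : Symmetrify (Vertex Y)} (p : Walk x y) (q : Walk y z) :
    walkClass I (p.comp q) = walkClass I p * walkClass I q := by
  refine (Quotient.sound (s := homotopySetoid I (Symmetrify.of.obj source)) ?_).symm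
  exact Homotopic.conj_comp_conj (treeWalk x) (treeWalk y) (treeWalk z) p q

theorem walkClass_reverse {x y : Symmetrify (Vertex Y)} (p : Walk x y) :
    walkClass I p.reverse = (walkClass I p)⁻¹ := by
  refine (inv_eq_of_mul_eq_one_right ?_).symm
  rw [← walkClass_comp, walkClass_eq_of_homotopic (Homotopic.comp_reverse p), walkClass_nil]

/-- A walk is homotopic to the stationary one if its class is trivial. -/
theorem homotopic_nil_of_walkClass_eq_one {x : Symmetrify (Vertex Y)} {p : Walk x x}
    (h : walkClass I p = 1) : Homotopic I p Path.nil := by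
  exact Homotopic.nil_of_conj (treeWalk x)
    (Quotient.exact (s := homotopySetoid I (Symmetrify.of.obj source)) h)

variable (I) in
/-- The class of the closed walk `a x` followed by the inverse of `a none`. -/
def generator (x : Option Y) : FundamentalGroup I source :=
  walkClass I (toWalk (arrowA x).toPath)

theorem walkClass_eq_one_of_comp_eq {x y : Symmetrify (Vertex Y)} (p : Walk x y)
    (h : (treeWalk x).comp p = treeWalk y) : walkClass I p = 1 := by
  refine Quotient.sound (s := homotopySetoid I (Symmetrify.of.obj source)) ?_
  change Homotopic I (((treeWalk x).comp p).comp (treeWalk y).reverse) Path.nil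
  rw [h]
  exact Homotopic.comp_reverse _

theorem generator_none : generator I none = 1 :=
  walkClass_eq_one_of_comp_eq _ (Path.nil_comp _)

theorem walkClass_arrowB_none : walkClass I (toWalk (arrowB (Y := Y) none).toPath) = 1 :=
  walkClass_eq_one_of_comp_eq _ rfl

theorem walkClass_arrowC (y : Y) : walkClass I (toWalk (arrowC y).toPath) = 1 :=
  walkClass_eq_one_of_comp_eq _ rfl

theorem walkClass_pathAB (x y : Option Y) : walkClass I (toWalk (pathAB x y)) =
    generator I x * walkClass I (toWalk (arrowB y).toPath) :=
  walkClass_comp (toWalk (arrowA x).toPath) (toWalk (arrowB y).toPath)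

theorem walkClass_pathAC (x : Option Y) (y : Y) : walkClass I (toWalk (pathAC x y)) =
    generator I x := by
  have := walkClass_comp (I := I) (toWalk (arrowA x).toPath) (toWalk (arrowC y).toPath)
  rwa [walkClass_arrowC, mul_one] at this

/-- Since `a none` and `b none` have trivial class, `homotopic_comm` identifies the class of `b y`
with that of `a y`. This turns the relators for `T` into products of generators. -/
theorem walkClass_arrowB (hc : ∀ y, c y = 0 ∨ c y = 1)
    (hT : ∀ x y z, T x y z → c x = c z ∧ c y = c z) (x : Option Y) :
    walkClass (relatorIdeal T c) (toWalk (arrowB x).toPath) = generator (relatorIdeal T c) x := by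
  cases x with
  | none => rw [walkClass_arrowB_none, generator_none]
  | some y =>
    have h := walkClass_eq_of_homotopic (homotopic_comm hc hT y)
    rw [walkClass_pathAB, walkClass_pathAB, walkClass_arrowB_none, generator_none, mul_one,
      one_mul] at h
    exact h.symm

theorem generator_eq_one (hc : ∀ y, c y = 0 ∨ c y = 1)
    (hT : ∀ x y z, T x y z → c x = c z ∧ c y = c z) {y : Y} (hy : c y = 1) :
    generator (relatorIdeal T c) (some y) = 1 := by
  have h := walkClass_eq_of_homotopic (homotopic_tip hc hT hy)
  rwa [walkClass_pathAC, walkClass_pathAC, generator_none] at h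

theorem generator_mul (hc : ∀ y, c y = 0 ∨ c y = 1)
    (hT : ∀ x y z, T x y z → c x = c z ∧ c y = c z) {x y z : Y} (h : T x y z) (hz : c z = 0) :
    generator (relatorIdeal T c) (some x) * generator (relatorIdeal T c) (some y) =
      generator (relatorIdeal T c) (some z) := by
  have h := walkClass_eq_of_homotopic (homotopic_mul hc hT h hz)
  rwa [walkClass_pathAB, walkClass_pathAB, walkClass_arrowB hc hT, walkClass_arrowB hc hT,
    generator_none, mul_one] at h

/-- A homomorphism that sends the weights of the arrows to the generators sends the weight of each
walk to its class. -/
theorem map_walkWeight {G : Type v} [Group G] {β : Y → G} (hc : ∀ y, c y = 0 ∨ c y = 1)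
    (hT : ∀ x y z, T x y z → c x = c z ∧ c y = c z)
    (φ : G →* FundamentalGroup (relatorIdeal T c) (source : Vertex Y))
    (hφ : ∀ y, φ (β y) = generator (relatorIdeal T c) (some y)) {x y : Symmetrify (Vertex Y)}
    (p : Walk x y) : φ (walkWeight (arrowWeight β) p) = walkClass (relatorIdeal T c) p := by
  have helim : ∀ x : Option Y, φ (x.elim 1 β) = generator (relatorIdeal T c) x := fun x => by
    cases x with
    | none => rw [generator_none]; exact map_one φ
    | some y => exact hφ y
  have harrow : ∀ {x y : Vertex Y} (e : x ⟶ y),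
      φ (arrowWeight β e) = walkClass (relatorIdeal T c) (toWalk e.toPath) := fun e => by
    rcases e with x | x | y
    · exact helim x
    · exact (helim x).trans (walkClass_arrowB hc hT x).symm
    · exact (map_one φ).trans (walkClass_arrowC y).symm
  induction p with
  | nil => exact (map_one φ).trans (walkClass_nil _).symm
  | cons p e ih =>
    rw [← Path.comp_toPath_eq_cons, walkClass_comp, ← ih, walkWeight_comp, map_mul]
    congr 1
    rcases e with a | a
    · exact (congrArg φ (one_mul _)).trans (harrow a)
    · exact (congrArg φ (one_mul _)).trans ((map_inv φ _).trans
        ((congrArg _ (harrow a)).trans (walkClass_reverse _).symm))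

/-- The fundamental group of the quiver with the relator ideal is the group generated by the `β y`
with the relations `β x * β y = β z` for `T x y z` and `β y = 1` for `c y = 1`. -/
theorem nonempty_fundamentalGroup_mulEquiv {G : Type v} [Group G] {β : Y → G}
    (hc : ∀ y, c y = 0 ∨ c y = 1) (hT : ∀ x y z, T x y z → c x = c z ∧ c y = c z)
    (hβ : ∀ y, c y = 1 → β y = 1) (hmul : ∀ x y z, T x y z → β x * β y = β z)
    (hgen : Subgroup.closure (Set.range β) = ⊤)
    (hlift : ∀ (H : Type) [Group H] (f : Y → H), (∀ y, c y = 1 → f y = 1) →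
      (∀ x y z, T x y z → c z = 0 → f x * f y = f z) → ∃ φ : G →* H, ∀ y, φ (β y) = f y)
    (v₀ : Vertex Y) : Nonempty (FundamentalGroup (relatorIdeal T c) v₀ ≃* G) := by
  obtain ⟨φ, hφ⟩ := hlift (FundamentalGroup (relatorIdeal T c) (source : Vertex Y))
    (fun y => generator (relatorIdeal T c) (some y)) (fun y hy => generator_eq_one hc hT hy)
    (fun x y z h hz => generator_mul hc hT h hz)
  have hI := weightProj_mem_relatorIdeal (k := k) (T := T) (c := c) (β := β)
    (fun y => (hc y).imp_right (hβ y)) hmul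
  refine ⟨MulEquiv.ofBijective (weightHom hI v₀) ⟨?_, ?_⟩⟩
  · rw [injective_iff_map_eq_one]
    rintro ⟨p⟩ hp
    refine Quotient.sound (s := homotopySetoid _ (Symmetrify.of.obj v₀))
      (homotopic_nil_of_walkClass_eq_one ?_)
    have hp' : walkWeight (arrowWeight β) p = 1 := hp
    -- Injectivity: `φ` recovers the class of a walk from its weight.
    rw [← map_walkWeight hc hT φ hφ p, hp', map_one]
  · rw [← MonoidHom.range_eq_top, ← top_le_iff, ← hgen, Subgroup.closure_le]
    rintro _ ⟨y, rfl⟩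
    -- Surjectivity: this loop has weight `β y`, and the tree carries it to `v₀` with its weight
    -- unchanged.
    let q : Walk (Symmetrify.of.obj source) (Symmetrify.of.obj (source : Vertex Y)) :=
      (toWalk (arrowA (some y)).toPath).comp (toWalk (arrowA none).toPath).reverse
    have hq : walkWeight (arrowWeight β) q = β y := by
      change 1 * β y * (1 : G)⁻¹ = β y
      simp
    refine ⟨Quotient.mk (homotopySetoid _ (Symmetrify.of.obj v₀))
      (((treeWalk v₀).reverse.comp q).comp (treeWalk v₀)), ?_⟩
    change walkWeight (arrowWeight β) (((treeWalk v₀).reverse.comp q).comp (treeWalk v₀)) = β y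
    rw [walkWeight_comp, walkWeight_comp, walkWeight_reverse, walkWeight_treeWalk, hq]
    simp

end Vertex

end BoundQuiver

end

/-! ### Assembling the groups on one quiver -/

theorem theoremA (k : Type u) [Field k] {n : ℕ} (G : Fin n → Type v)
    [∀ i, Group (G i)] (hG : ∀ i, Group.IsFinitelyPresented (G i)) :
    ∃ (A : Type u) (_ : Ring A) (_ : Algebra k A)
      (Q : Type) (_ : Fintype Q) (_ : Quiver.{0} Q)
      (I : Fin n → TwoSidedIdeal (BoundQuiver.PathAlgebra k Q)),
      FiniteDimensional k A ∧
      ∀ i, BoundQuiver.IsPresentation A (I i) ∧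
        ∀ v₀ : Q, Nonempty (BoundQuiver.FundamentalGroup (I i) v₀ ≃* G i) := by
  classical
  choose W hW β hgen hlift using fun i => (hG i).exists_multiplication_table
  have := fun i => Fintype.ofFinite (W i)
  let Y := Σ i, W i
  -- The tables are kept inside their blocks, so each `c i` is constant on related triples.
  let T : Y → Y → Y → Prop := fun x y z => ∃ (i : Fin n) (x' y' z' : W i),
    x = ⟨i, x'⟩ ∧ y = ⟨i, y'⟩ ∧ z = ⟨i, z'⟩ ∧ β i x' * β i y' = β i z'
  -- The `i`-th shift leaves block `i` alone and switches off all the others; `γ i` is accordingly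
  -- trivial outside block `i`.
  let c : Fin n → Y → k := fun i y => if y.1 = i then 0 else 1
  let γ : ∀ i, Y → G i := fun i y => if h : y.1 = i then β i (h ▸ y.2) else 1
  have hγ : ∀ i (y : W i), γ i ⟨i, y⟩ = β i y := fun i y => by simp [γ]
  have hγ' : ∀ i (y : Y), y.1 ≠ i → γ i y = 1 := fun i y h => by simp [γ, h]
  -- The common algebra is the quotient by the unshifted ideal.
  refine ⟨_, _, _, BoundQuiver.Vertex Y, inferInstance, inferInstance,
    fun i => BoundQuiver.Vertex.relatorIdeal T (c i),
    BoundQuiver.Vertex.finiteDimensional_quotient (BoundQuiver.Vertex.relatorIdeal T 0),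
    fun i => ⟨BoundQuiver.Vertex.isPresentation_relatorIdeal T (c i),
      BoundQuiver.Vertex.nonempty_fundamentalGroup_mulEquiv (β := γ i) ?_ ?_ ?_ ?_ ?_ ?_⟩⟩
  · intro y
    simp only [c]
    split_ifs <;> simp
  · rintro _ _ _ ⟨j, x, y, z, rfl, rfl, rfl, -⟩
    exact ⟨rfl, rfl⟩
  · intro y hy
    refine hγ' i y fun h => ?_
    simp [c, h] at hy
  · rintro _ _ _ ⟨j, x, y, z, rfl, rfl, rfl, h⟩
    by_cases hj : j = i
    · subst hj
      simpa only [hγ] using h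
    · rw [hγ' _ _ hj, hγ' _ _ hj, hγ' _ _ hj, mul_one]
  · rw [← top_le_iff, ← hgen i]
    refine Subgroup.closure_mono ?_
    rintro _ ⟨y, rfl⟩
    exact ⟨⟨i, y⟩, hγ i y⟩
  · intro H _ f hf hmul
    obtain ⟨φ, hφ⟩ := hlift i H (fun y => f ⟨i, y⟩) fun x y z h =>
      hmul _ _ _ ⟨i, x, y, z, rfl, rfl, rfl, h⟩ (by simp [c])
    refine ⟨φ, fun ⟨j, y⟩ => ?_⟩
    by_cases hj : j = i
    · subst hj
      rw [hγ, hφ]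
    · rw [hγ' _ _ hj, map_one, hf]
      simp [c, hj]
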